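/- For an irreducible complex character $\chi$ of a finite group $G$, let $\ker\chi=\{g\in G:\chi(g)=\chi(1)\}$ and let $\mathrm{cod}(\chi)=|G:\ker\chi|/\chi(1)$ be its codegree; let $\mathrm{cod}(G)=\{\mathrm{cod}(\chi):\chi\in\mathrm{Irr}(G)\}$. The nilpotent residual of $G$ is the smallest normal subgroup of $G$ with nilpotent quotient. Let $G$ be a finite solvable group and let $N$ be the nilpotent residual of $G$. Assume that $|G/N|$ has at least two distinct prime divisors. Then $|\mathrm{cod}(G)|=4$ if and only if there are distinct primes $p\ne q$ such that $G$ is the direct product of an elementary abelian $p$-group and an elementary abelian $q$-group. -/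

import Mathlib

namespace CharacterCodegree

/-- `Irr(G)`: the set of irreducible complex characters of `G`, as functions `G → ℂ`.
Every finite-dimensional complex vector space is isomorphic to one in `Type`. -/
def Irr (G : Type*) [Group G] : Set (G → ℂ) :=
  {χ | ∃ (V : Type) (_ : AddCommGroup V) (_ : Module ℂ V) (_ : FiniteDimensional ℂ V)
    (ρ : Representation ℂ G V), ρ.IsIrreducible ∧ ρ.character = χ}

/-- The kernel `{g : χ(g) = χ(1)}` of a character. -/
def charKer {G : Type*} [Group G] (χ : G → ℂ) : Set G :=
  {g | χ g = χ 1}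

/-- The codegree `|G : ker χ| / χ(1)` of a character `χ` of a finite group `G`. -/
noncomputable def cod {G : Type*} [Group G] (χ : G → ℂ) : ℂ :=
  ((Nat.card G : ℂ) / (Nat.card (charKer χ) : ℂ)) / χ 1

/-- `cod(G)`: the set of codegrees of the irreducible complex characters of `G`. -/
def codSet (G : Type*) [Group G] : Set ℂ :=
  cod '' Irr G

/-- The nilpotent residual of a finite group `G`: the smallest normal subgroup whose quotient
is nilpotent, i.e. the intersection of all normal subgroups with nilpotent quotient. -/
def nilpotentResidual (G : Type*) [Group G] : Subgroup G :=
  sInf {K | ∃ _ : K.Normal, Group.IsNilpotent (G ⧸ K)}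

/-- `H` is an elementary abelian `p`-group: abelian with every element of order dividing `p`. -/
def IsElementaryAbelian (p : ℕ) (H : Type*) [Group H] : Prop :=
  (∀ a b : H, a * b = b * a) ∧ ∀ a : H, a ^ p = 1

/-- `G` is the (internal) direct product of its subgroups `P` and `Q`. -/
def IsDirectProduct {G : Type*} [Group G] (P Q : Subgroup G) : Prop :=
  P.Normal ∧ Q.Normal ∧ P ⊓ Q = ⊥ ∧ P ⊔ Q = ⊤

/-- The kernel of a character is the kernel of any representation that affords it. -/
theorem charKer_character {G : Type*} [Group G] [Finite G] {V : Type*} [AddCommGroup V]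
    [Module ℂ V] [FiniteDimensional ℂ V] (ρ : Representation ℂ G V) :
    charKer ρ.character = (MonoidHom.ker ρ : Set G) := by
  classical
  ext g
  simp only [charKer, Set.mem_ofPred_eq, SetLike.mem_coe, MonoidHom.mem_ker]
  constructor
  swap
  · intro h
    simp [Representation.character, h]
  intro h
  set f : Module.End ℂ V := ρ g with hf
  set n := Nat.card G with hn
  have hn0 : n ≠ 0 := Nat.card_pos.ne'
  have hpow : f ^ n = 1 := by rw [hf, ← map_pow, hn, pow_card_eq_one', map_one]
  have htr : LinearMap.trace ℂ V f = Module.finrank ℂ V := by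
    simpa [Representation.character] using h
  have hroot : ∀ z ∈ f.charpoly.roots, z ^ n = 1 := by
    intro z hz
    have hz' : f.HasEigenvalue z := by
      rw [Module.End.hasEigenvalue_iff_isRoot_charpoly]
      exact Polynomial.isRoot_of_mem_roots hz
    obtain ⟨v, hv⟩ := hz'.exists_hasEigenvector
    have h1 := hv.pow_apply n
    rw [hpow, Module.End.one_apply] at h1
    have h2 : (z ^ n - 1) • v = 0 := by rw [sub_smul, one_smul, ← h1, sub_self]
    rcases smul_eq_zero.1 h2 with h3 | h3
    · exact sub_eq_zero.1 h3
    · exact absurd h3 hv.2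
  have hsplit : f.charpoly.Splits := IsAlgClosed.splits _
  have hcard : f.charpoly.roots.card = Module.finrank ℂ V := by
    rw [← hsplit.natDegree_eq_card_roots, LinearMap.charpoly_natDegree]
  have hsum : f.charpoly.roots.sum = Module.finrank ℂ V := by
    rw [← htr, Module.End.trace_eq_sum_roots_charpoly_of_splits hsplit]
  have key : ∀ s : Multiset ℂ, (∀ z ∈ s, ‖z‖ = 1) →
      s.sum.re ≤ s.card ∧ (s.sum.re = s.card → ∀ z ∈ s, z.re = 1) := by
    intro s
    induction s using Multiset.induction_on with
    | empty => simp
    | cons a s ih =>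
      intro hs
      obtain ⟨h1, h2⟩ := ih fun z hz => hs z (Multiset.mem_cons_of_mem hz)
      have h3 : a.re ≤ 1 := (Complex.re_le_norm a).trans (hs a (Multiset.mem_cons_self a s)).le
      simp only [Multiset.sum_cons, Complex.add_re, Multiset.card_cons, Nat.cast_add, Nat.cast_one]
      refine ⟨by linarith, fun h z hz => ?_⟩
      rcases Multiset.mem_cons.1 hz with rfl | hz
      · linarith
      · exact h2 (by linarith) z hz
  have hnorm : ∀ z ∈ f.charpoly.roots, ‖z‖ = 1 := fun z hz =>
    Complex.norm_eq_one_of_pow_eq_one (hroot z hz) hn0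
  have hone : ∀ z ∈ f.charpoly.roots, z = 1 := by
    intro z hz
    have hre : z.re = 1 := (key _ hnorm).2 (by rw [hsum, hcard]; simp) z hz
    have h1 := Complex.sq_norm z
    rw [hnorm z hz, Complex.normSq_apply, hre] at h1
    apply Complex.ext
    · simpa using hre
    · have : z.im * z.im = 0 := by linarith
      simpa using this
  have hchar : f.charpoly = (Polynomial.X - Polynomial.C 1) ^ f.charpoly.roots.card := by
    conv_lhs => rw [hsplit.eq_prod_roots_of_monic f.charpoly_monic,
      Multiset.eq_replicate_card.2 hone]
    simp
  have hsq : Squarefree (minpoly ℂ f) := by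
    have h1 : (Polynomial.X ^ n - Polynomial.C (1 : ℂ)).Separable :=
      Polynomial.separable_X_pow_sub_C 1 (by exact_mod_cast hn0) one_ne_zero
    exact h1.squarefree.squarefree_of_dvd (minpoly.dvd ℂ f (by simp [hpow]))
  have hdvd : minpoly ℂ f ∣ (Polynomial.X - Polynomial.C 1) ^ (f.charpoly.roots.card + 1) :=
    ((minpoly.dvd ℂ f f.aeval_self_charpoly).trans hchar.dvd).trans (pow_dvd_pow _ (Nat.le_succ _))
  rw [hsq.dvd_pow_iff_dvd (Nat.succ_ne_zero _)] at hdvd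
  have h0 := (minpoly.dvd_iff).1 hdvd
  simpa [sub_eq_zero] using h0

end CharacterCodegree

/-! A prime dividing |G/N| divides |G : G'|. So if p ≠ q are primes dividing |G/N|, then G has
linear characters of orders 1, p, q and pq, and the codegree of a linear character is its order.
Having four codegrees thus means that they are exactly the divisors of pq. The main point is that G
is then abelian (`commutator_eq_bot_of_codegreesDvd`). For abelian G, all codegrees divide n exactly
when the exponent does, which settles both directions.

In a minimal counterexample to commutativity, G' is minimal normal, hence elementary abelian for a
prime l. Take a self-centralizing abelian A ≥ G' and a character θ of A nontrivial on G'. The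
stabilizer of θ is A, so an irreducible character above θ has degree |G : A|; its kernel is the core
K of ker θ, and its codegree is |A : K| (`relIndex_coreKer_mem_codSet`). Since K ∩ G' = 1, |G'|
divides this squarefree number, so |G'| = l. Moreover K ≤ Z(G) ≤ A, so |A : K| = |A : Z(G)| |Z(G) :
K|. If G' is central, l divides both factors; if not, θ can be modified so that it does. Either way
l² divides a squarefree number. -/

namespace CharacterCodegree

open Module

/-! ### Irreducible representations lying above a linear character of a subgroup. -/

/-- Irreducibility in terms of invariant submodules. -/
theorem isIrreducible_iff {G V : Type*} [Group G] [AddCommGroup V] [Module ℂ V]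
    (ρ : Representation ℂ G V) :
    ρ.IsIrreducible ↔ Nontrivial V ∧
      ∀ W : Submodule ℂ V, (∀ g, ∀ w ∈ W, ρ g w ∈ W) → W = ⊥ ∨ W = ⊤ := by
  constructor
  · intro h
    refine ⟨?_, fun W hW => ?_⟩
    · by_contra hV
      rw [not_nontrivial_iff_subsingleton] at hV
      refine bot_ne_top (α := Subrepresentation ρ) ?_
      apply Subrepresentation.toSubmodule_injective
      exact Subsingleton.elim _ _
    · rcases h.eq_bot_or_eq_top ⟨W, hW⟩ with h1 | h1
      · exact Or.inl (congrArg Subrepresentation.toSubmodule h1)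
      · exact Or.inr (congrArg Subrepresentation.toSubmodule h1)
  · rintro ⟨hV, h⟩
    refine { exists_pair_ne := ⟨⊥, ⊤, fun h1 => ?_⟩, eq_bot_or_eq_top := fun W => ?_ }
    · exact bot_ne_top (α := Submodule ℂ V) (congrArg Subrepresentation.toSubmodule h1)
    · rcases h W.toSubmodule W.apply_mem_toSubmodule with h1 | h1
      · exact Or.inl (Subrepresentation.toSubmodule_injective h1)
      · exact Or.inr (Subrepresentation.toSubmodule_injective h1)

/-- `ρ` has a nonzero vector on which `A` acts through the linear character `θ`. -/
def HasWeightVector {G V : Type*} [Group G] [AddCommGroup V] [Module ℂ V]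
    (ρ : Representation ℂ G V) (A : Subgroup G) (θ : A →* ℂˣ) : Prop :=
  ∃ v : V, v ≠ 0 ∧ ∀ a : A, ρ a v = (θ a : ℂ) • v

/-- On the spaces `Fin n → ℂ` a least dimension can be chosen by `Nat.find`, and they lie in `Type`,
as `Irr` demands. -/
theorem HasWeightVector.exists_fin {G V : Type*} [Group G] [AddCommGroup V] [Module ℂ V]
    [FiniteDimensional ℂ V] {ρ : Representation ℂ G V} {A : Subgroup G} {θ : A →* ℂˣ}
    (h : HasWeightVector ρ A θ) :
    ∃ σ : Representation ℂ G (Fin (finrank ℂ V) → ℂ), HasWeightVector σ A θ := by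
  obtain ⟨v, hv, h⟩ := h
  let e := (finBasis ℂ V).equivFun
  refine ⟨⟨⟨fun g => e.conj (ρ g), ?_⟩, ?_⟩, e v, ?_, ?_⟩
  · simp [Module.End.one_eq_id]
  · intro g h
    simp [Module.End.mul_eq_comp, LinearEquiv.conj_comp]
  · simpa using hv
  · intro a
    simp [LinearEquiv.conj_apply_apply, h a]

/-- For right translation on functions `G → ℂ`, the extension of θ by zero is a weight vector. -/
theorem exists_hasWeightVector {G : Type*} [Group G] [Finite G] (A : Subgroup G) (θ : A →* ℂˣ) :
    ∃ n : ℕ, ∃ ρ : Representation ℂ G (Fin n → ℂ), HasWeightVector ρ A θ := by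
  classical
  cases nonempty_fintype G
  let ρ : Representation ℂ G (G → ℂ) :=
    { toFun := fun g => LinearMap.funLeft ℂ ℂ (fun x => x * g)
      map_one' := by ext; simp [LinearMap.funLeft]
      map_mul' := fun g h => by
        ext f x
        simp [LinearMap.funLeft_apply, mul_assoc] }
  refine ⟨_, HasWeightVector.exists_fin (ρ := ρ)
    ⟨fun x => if hx : x ∈ A then (θ ⟨x, hx⟩ : ℂ) else 0, ?_, ?_⟩⟩
  · intro h
    simpa [A.one_mem] using congrFun h 1
  · intro a
    ext x
    simp only [ρ, MonoidHom.coe_mk, OneHom.coe_mk, LinearMap.funLeft_apply, Pi.smul_apply,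
      smul_eq_mul]
    by_cases hx : x ∈ A
    · rw [dif_pos (A.mul_mem hx a.2), dif_pos hx, mul_comm, ← Units.val_mul, ← map_mul]
      rfl
    · rw [dif_neg hx, dif_neg (fun h => hx ((A.mul_mem_cancel_right a.2).1 h)), mul_zero]

/-- A representation of least dimension with a weight vector is irreducible. -/
theorem exists_irreducible_hasWeightVector {G : Type*} [Group G] [Finite G] (A : Subgroup G)
    (θ : A →* ℂˣ) : ∃ n : ℕ, ∃ ρ : Representation ℂ G (Fin n → ℂ),
      ρ.IsIrreducible ∧ HasWeightVector ρ A θ := by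
  classical
  have hex := exists_hasWeightVector A θ
  obtain ⟨ρ, hρ⟩ := Nat.find_spec hex
  refine ⟨_, ρ, (isIrreducible_iff ρ).2 ⟨?_, fun W hW => ?_⟩, hρ⟩
  · obtain ⟨v, hv, -⟩ := hρ
    exact ⟨v, 0, hv⟩
  obtain ⟨v, hv, hθ⟩ := hρ
  have hmin : ∀ m, (∃ σ : Representation ℂ G (Fin m → ℂ), HasWeightVector σ A θ) →
      Nat.find hex ≤ m := fun m hm => Nat.find_min' hex hm
  -- One of `W` and its quotient inherits the weight vector, so by minimality it has full dimension.
  by_cases hvW : v ∈ W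
  · right
    have h1 : HasWeightVector (ρ.subrepresentation W fun g w hw => hW g w hw) A θ :=
      ⟨⟨v, hvW⟩, fun h => hv (congrArg Subtype.val h), fun a => Subtype.ext (hθ a)⟩
    have h2 := hmin _ h1.exists_fin
    apply Submodule.eq_top_of_finrank_eq
    refine le_antisymm (Submodule.finrank_le W) ?_
    simpa using h2
  · left
    have h1 : HasWeightVector (ρ.quotient W fun g w hw => hW g w hw) A θ := by
      refine ⟨W.mkQ v, fun h => hvW ((Submodule.Quotient.mk_eq_zero W).1 h), fun a => ?_⟩
      rw [← map_smul, ← hθ a]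
      rfl
    have h2 := hmin _ h1.exists_fin
    have h3 := Submodule.finrank_quotient_add_finrank W
    rw [finrank_fin_fun] at h3
    rw [← Submodule.finrank_eq_zero (R := ℂ)]
    omega

/-! ### Degree and kernel above a character with stabilizer in `A`. -/

/-- The stabilizer of `θ` under conjugation is contained in `A`. -/
def StabilizerLE {G : Type*} [Group G] (A : Subgroup G) [hA : A.Normal] (θ : A →* ℂˣ) : Prop :=
  ∀ g ∉ A, ∃ a : A, θ ⟨g * a * g⁻¹, hA.conj_mem a a.2 g⟩ ≠ θ a

section Weight

variable {G V : Type*} [Group G] [AddCommGroup V] [Module ℂ V]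
  {ρ : Representation ℂ G V} {A : Subgroup G} [hA : A.Normal] {θ : A →* ℂˣ} {v : V}

theorem span_orbit_eq_top (hρ : ρ.IsIrreducible) (hv : v ≠ 0) :
    Submodule.span ℂ (Set.range fun g => ρ g v) = ⊤ := by
  refine (((isIrreducible_iff ρ).1 hρ).2 _ fun g w hw => ?_).resolve_left fun h => ?_
  · induction hw using Submodule.span_induction with
    | mem x hx =>
      obtain ⟨k, rfl⟩ := hx
      refine Submodule.subset_span ⟨g * k, ?_⟩
      simp
    | zero => simp
    | add x y _ _ hx hy => rw [map_add]; exact add_mem hx hy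
    | smul c x _ hx => rw [map_smul]; exact Submodule.smul_mem _ c hx
  · rw [Submodule.span_eq_bot] at h
    exact hv (by simpa using h (ρ 1 v) ⟨1, rfl⟩)

theorem apply_conj_weight (hθ : ∀ a : A, ρ a v = (θ a : ℂ) • v) (g : G) (a : A) :
    ρ a (ρ g v) = (θ ⟨g⁻¹ * a * g, by simpa using hA.conj_mem a a.2 g⁻¹⟩ : ℂ) • ρ g v := by
  rw [← map_smul, ← hθ]
  simp only [← Module.End.mul_apply, ← map_mul]
  congr 2
  group

/-- The translates of `v` by coset representatives of `A` form a basis: every `ρ g v` is a multiple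
of one of them, and their weights are conjugates of θ, distinct by `hst`. -/
theorem finrank_eq_index [Finite G] (hρ : ρ.IsIrreducible) (hv : v ≠ 0)
    (hθ : ∀ a : A, ρ a v = (θ a : ℂ) • v) (hst : StabilizerLE A θ) :
    finrank ℂ V = A.index := by
  classical
  have := Fintype.ofFinite (G ⧸ A)
  let u : G ⧸ A → V := fun x => ρ x.out v
  have hne : ∀ g, ρ g v ≠ 0 := fun g h => hv <| by
    have := congrArg (ρ g⁻¹) h
    simpa using this
  have hmem : ∀ (g : G) (a : A), g⁻¹ * a * g ∈ A := fun g a => by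
    simpa using hA.conj_mem a a.2 g⁻¹
  let φ : G ⧸ A → (A →* ℂ) := fun x =>
    { toFun := fun a => (θ ⟨x.out⁻¹ * a * x.out, hmem _ a⟩ : ℂ)
      map_one' := by
        have : (⟨x.out⁻¹ * (1 : A) * x.out, hmem x.out 1⟩ : A) = 1 := by ext; simp
        rw [this]; simp
      map_mul' := fun a b => by
        rw [← Units.val_mul, ← map_mul]
        congr 2
        ext
        simp [mul_assoc] }
  have hφ : Function.Injective φ := by
    intro x y hxy
    by_contra hne
    have hg : x.out⁻¹ * y.out ∉ A := fun h => hne <| by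
      rw [← QuotientGroup.eq] at h
      simpa using h
    obtain ⟨a, ha⟩ := hst _ hg
    apply ha
    have h1 := DFunLike.congr_fun hxy ⟨y.out * a * y.out⁻¹, hA.conj_mem a a.2 _⟩
    have h2 : φ x ⟨y.out * a * y.out⁻¹, hA.conj_mem a a.2 _⟩ =
        (θ ⟨(x.out⁻¹ * y.out) * a * (x.out⁻¹ * y.out)⁻¹, hA.conj_mem a a.2 _⟩ : ℂ) :=
      congrArg (fun b => (θ b : ℂ)) (Subtype.ext (by simp [mul_assoc]))
    have h3 : φ y ⟨y.out * a * y.out⁻¹, hA.conj_mem a a.2 _⟩ = (θ a : ℂ) :=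
      congrArg (fun b => (θ b : ℂ)) (Subtype.ext (by simp [mul_assoc]))
    exact Units.ext (h2.symm.trans (h1.trans h3))
  have hli : LinearIndependent ℂ u := by
    rw [Fintype.linearIndependent_iff]
    intro c hc x
    -- Applying `ρ a` and then `f` to the relation gives a relation among the distinct characters `φ
    -- y`, with coefficients `c y * f (u y)`; Dedekind independence kills them.
    have h1 : ∀ f : Dual ℂ V, c x * f (u x) = 0 := by
      intro f
      have h2 := Fintype.linearIndependent_iff.1
        ((linearIndependent_monoidHom A ℂ).comp φ hφ) (fun y => c y * f (u y)) ?_ x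
      · exact h2
      · ext a
        have h3 := congrArg (fun w => f (ρ a w)) hc
        simp only [map_sum, map_smul, map_zero, u, apply_conj_weight hθ] at h3
        simp only [Finset.sum_apply, Pi.smul_apply, Pi.zero_apply, Function.comp_apply, u]
        rw [← h3]
        refine Finset.sum_congr rfl fun y _ => ?_
        simp only [smul_eq_mul, φ, MonoidHom.coe_mk, OneHom.coe_mk]
        ring
    have h2 : c x • u x = 0 := by
      rw [← Module.forall_dual_apply_eq_zero_iff ℂ]
      intro f
      rw [map_smul]
      exact h1 f
    exact (smul_eq_zero.1 h2).resolve_right (hne _)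
  have hspan : ⊤ ≤ Submodule.span ℂ (Set.range u) := by
    rw [← span_orbit_eq_top hρ hv, Submodule.span_le]
    rintro _ ⟨g, rfl⟩
    let x : G ⧸ A := g
    have hx : x.out⁻¹ * g ∈ A := by
      rw [← QuotientGroup.eq]; simp [x]
    have h1 : ρ g v = (θ ⟨_, hx⟩ : ℂ) • u x := by
      rw [← map_smul, ← hθ, ← Module.End.mul_apply, ← map_mul]
      simp
    simp only [SetLike.mem_coe, h1]
    exact Submodule.smul_mem _ _ (Submodule.subset_span ⟨x, rfl⟩)
  rw [finrank_eq_card_basis (Basis.mk hli hspan), Subgroup.index, Nat.card_eq_fintype_card]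

/-- The largest normal subgroup of `G` contained in the kernel of `θ`. -/
def coreKer {G : Type*} [Group G] (A : Subgroup G) (θ : A →* ℂˣ) : Subgroup G :=
  (θ.ker.map A.subtype).normalCore

theorem mem_map_ker {G : Type*} [Group G] {A : Subgroup G} {θ : A →* ℂˣ} {g : G} :
    g ∈ θ.ker.map A.subtype ↔ ∃ h : g ∈ A, θ ⟨g, h⟩ = 1 := by
  simp [Subgroup.mem_map, MonoidHom.mem_ker]

/-- A kernel element stabilizes θ, so it lies in `A`, and θ is 1 on it; the kernel being normal, it
lies in the core. Conversely, all conjugates of a core element fix `v`, so the element fixes every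
`ρ h v`. -/
theorem ker_eq_coreKer (hρ : ρ.IsIrreducible) (hv : v ≠ 0)
    (hθ : ∀ a : A, ρ a v = (θ a : ℂ) • v) (hst : StabilizerLE A θ) :
    ρ.ker = coreKer A θ := by
  apply le_antisymm
  · rw [coreKer, Subgroup.normal_le_normalCore]
    intro g hg
    have hcan : ∀ a b : A, ρ a v = ρ b v → θ a = θ b := fun a b h => by
      rw [hθ, hθ] at h
      exact Units.ext (smul_left_injective ℂ hv h)
    have hgA : g ∈ A := by
      by_contra hgA
      obtain ⟨a, ha⟩ := hst g hgA
      refine ha (hcan _ _ ?_)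
      simp [MonoidHom.mem_ker.1 hg, map_mul]
      have : ρ g⁻¹ = 1 := MonoidHom.mem_ker.1 (inv_mem hg)
      simp [this]
    refine mem_map_ker.2 ⟨hgA, ?_⟩
    rw [← map_one θ]
    exact hcan _ _ (by simp [MonoidHom.mem_ker.1 hg])
  · intro g hg
    rw [MonoidHom.mem_ker]
    apply LinearMap.ext_on_range (span_orbit_eq_top hρ hv)
    intro h
    have h1 : h⁻¹ * g * h ∈ coreKer A θ := by
      simpa [coreKer] using (Subgroup.normalCore_normal _).conj_mem g hg h⁻¹
    obtain ⟨h2, h3⟩ := mem_map_ker.1 (Subgroup.normalCore_le _ h1)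
    have h4 : ρ g (ρ h v) = ρ h (ρ (⟨_, h2⟩ : A) v) := by
      simp only [← Module.End.mul_apply, ← map_mul]
      congr 2
      group
    rw [h4, hθ, h3]
    simp

end Weight

theorem coreKer_le {G : Type*} [Group G] {A : Subgroup G} {θ : A →* ℂˣ} : coreKer A θ ≤ A :=
  (Subgroup.normalCore_le _).trans (Subgroup.map_subtype_le _)

/-! ### Codegrees as indices, and inflation from quotients. -/

/-- The codegree is the index of the kernel divided by the degree. -/
theorem cod_character {G V : Type*} [Group G] [Finite G] [AddCommGroup V] [Module ℂ V]
    [FiniteDimensional ℂ V] (ρ : Representation ℂ G V) :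
    cod ρ.character = (ρ.ker.index : ℂ) / finrank ℂ V := by
  rw [cod, charKer_character, Representation.char_one]
  congr 1
  rw [← ρ.ker.card_mul_index]
  have : (Nat.card ρ.ker : ℂ) ≠ 0 := by exact_mod_cast Nat.card_pos.ne'
  push_cast
  exact mul_div_cancel_left₀ _ this

theorem relIndex_coreKer_mem_codSet {G : Type*} [Group G] [Finite G] (A : Subgroup G)
    [A.Normal] (θ : A →* ℂˣ) (hst : StabilizerLE A θ) :
    ((coreKer A θ).relIndex A : ℂ) ∈ codSet G := by
  obtain ⟨n, ρ, hρ, v, hv, hθ⟩ := exists_irreducible_hasWeightVector A θ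
  refine ⟨ρ.character, ⟨_, _, _, inferInstance, ρ, hρ, rfl⟩, ?_⟩
  rw [cod_character, ker_eq_coreKer hρ hv hθ hst, finrank_eq_index hρ hv hθ hst,
    ← Subgroup.relIndex_mul_index coreKer_le]
  have : (A.index : ℂ) ≠ 0 := by exact_mod_cast A.index_ne_zero_of_finite
  push_cast
  exact mul_div_cancel_right₀ _ this

/-- This is the case `A = ⊤`, where the stabilizer condition is vacuous. -/
theorem index_ker_mem_codSet {G : Type*} [Group G] [Finite G] (θ : G →* ℂˣ) :
    (θ.ker.index : ℂ) ∈ codSet G := by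
  have h := relIndex_coreKer_mem_codSet (⊤ : Subgroup G) (θ.comp (⊤ : Subgroup G).subtype)
    fun g hg => absurd (Subgroup.mem_top g) hg
  have h1 : coreKer ⊤ (θ.comp (⊤ : Subgroup G).subtype) = θ.ker := by
    have : ((θ.comp (⊤ : Subgroup G).subtype).ker.map (⊤ : Subgroup G).subtype) = θ.ker := by
      ext g
      simp [MonoidHom.mem_ker]
    rw [coreKer, this, Subgroup.normalCore_eq_self]
  rwa [h1, Subgroup.relIndex_top_right] at h

theorem codSet_quotient_subset {G : Type*} [Group G] [Finite G] (M : Subgroup G) [M.Normal] :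
    codSet (G ⧸ M) ⊆ codSet G := by
  rintro _ ⟨_, ⟨V, _, _, _, ρ, hρ, rfl⟩, rfl⟩
  let σ : Representation ℂ G V := ρ.comp (QuotientGroup.mk' M)
  refine ⟨σ.character, ⟨V, _, _, inferInstance, σ, ?_, rfl⟩, ?_⟩
  · rw [isIrreducible_iff] at hρ ⊢
    refine ⟨hρ.1, fun W hW => hρ.2 W fun g w hw => ?_⟩
    obtain ⟨g, rfl⟩ := QuotientGroup.mk'_surjective M g
    exact hW g w hw
  · rw [cod_character, cod_character]
    congr 2
    have : σ.ker = ρ.ker.comap (QuotientGroup.mk' M) := rfl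
    rw [this, Subgroup.index_comap_of_surjective _ (QuotientGroup.mk'_surjective M)]

/-! ### Abelian subgroups, indices and commutators. -/

open Subgroup
open scoped commutatorElement

/-- Characters of an abelian subgroup separate its elements from any other subgroup. -/
theorem exists_character_ne_one {G : Type*} [Group G] [Finite G] {A : Subgroup G}
    (hA : ∀ a ∈ A, ∀ b ∈ A, a * b = b * a) (D : Subgroup G) {x : G} (hx : x ∈ A) (hxD : x ∉ D) :
    ∃ θ : A →* ℂˣ, (∀ d : A, (d : G) ∈ D → θ d = 1) ∧ θ ⟨x, hx⟩ ≠ 1 := by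
  let _ : CommGroup A :=
    { (inferInstance : Group A) with mul_comm := fun a b => Subtype.ext (hA a a.2 b b.2) }
  by_contra! h
  exact hxD ((CommGroup.forall_monoidHom_apply_eq_one_iff ℂ (D.subgroupOf A) ⟨x, hx⟩).1
    fun φ hφ => h φ hφ)

/-- An abelian subgroup lies in a self-centralizing one. -/
theorem exists_self_centralizing {G : Type*} [Group G] [Finite G] {N : Subgroup G}
    (hN : ∀ a ∈ N, ∀ b ∈ N, a * b = b * a) :
    ∃ A : Subgroup G, N ≤ A ∧ (∀ a ∈ A, ∀ b ∈ A, a * b = b * a) ∧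
      ∀ g, (∀ a ∈ A, g * a = a * g) → g ∈ A := by
  obtain ⟨A, hNA, hA⟩ := (Set.toFinite {A : Subgroup G | ∀ a ∈ A, ∀ b ∈ A, a * b = b * a}
    ).exists_le_maximal hN
  refine ⟨A, hNA, hA.1, fun g hg => ?_⟩
  -- The subgroup generated by `A` and `g` is still abelian, so maximality puts `g` in `A`.
  have h1 : ∀ x ∈ insert g (A : Set G), ∀ y ∈ insert g (A : Set G), x * y = y * x := by
    rintro x (rfl | hx) y (rfl | hy)
    · rfl
    · exact hg y hy
    · exact (hg x hx).symm
    · exact hA.1 x hx y hy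
  have h2 := isMulCommutative_closure h1
  have h3 : closure (insert g (A : Set G)) ≤ A := hA.2
    (fun a ha b hb => congrArg Subtype.val (mul_comm' (⟨a, ha⟩ : Subgroup.closure _) ⟨b, hb⟩))
    fun a ha => subset_closure (Set.mem_insert_of_mem g ha)
  exact h3 (subset_closure (Set.mem_insert g _))

/-- `D` embeds in `A / (A ∩ K)`. -/
theorem card_dvd_relIndex {G : Type*} [Group G] {D K A : Subgroup G} [K.Normal] (hD : D ≤ A)
    (hDK : D ⊓ K = ⊥) : Nat.card D ∣ K.relIndex A := by
  refine card_dvd_of_injective ((QuotientGroup.mk' (K.subgroupOf A)).comp (inclusion hD)) ?_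
  rw [injective_iff_map_eq_one]
  intro d hd
  have h1 : inclusion hD d ∈ K.subgroupOf A := (QuotientGroup.eq_one_iff _).1 hd
  have h2 : (d : G) ∈ D ⊓ K := ⟨d.2, h1⟩
  rw [hDK, mem_bot] at h2
  exact Subtype.ext h2

theorem normal_of_commutator_le {G : Type*} [Group G] {A : Subgroup G} (h : commutator G ≤ A) :
    A.Normal :=
  ⟨fun a ha g => by
    have h1 : ⁅g, a⁆ * a ∈ A := A.mul_mem (h (commutator_mem_commutator (mem_top g) (mem_top a))) ha
    simpa [commutatorElement_def] using h1⟩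

theorem index_commutator_dvd_of_surjective {G H : Type*} [Group G] [Group H] {f : G →* H}
    (hf : Function.Surjective f) : (commutator H).index ∣ (commutator G).index := by
  rw [← index_comap_of_surjective _ hf]
  apply index_dvd_of_le
  rw [← map_le_iff_le_comap, commutator_def, map_commutator]
  exact commutator_mono le_top le_top

instance coreKer_normal {G : Type*} [Group G] (A : Subgroup G) (θ : A →* ℂˣ) :
    (coreKer A θ).Normal :=
  normalCore_normal _

theorem apply_eq_one_of_mem_coreKer {G : Type*} [Group G] {A : Subgroup G} {θ : A →* ℂˣ} {g : G}
    (hg : g ∈ coreKer A θ) (hgA : g ∈ A) : θ ⟨g, hgA⟩ = 1 :=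
  (mem_map_ker.1 (normalCore_le _ hg)).2

/-- All codegrees of `G` are divisors of `n`. -/
def CodegreesDvd (G : Type*) [Group G] (n : ℕ) : Prop :=
  ∀ c ∈ codSet G, ∃ d : ℕ, d ∣ n ∧ (d : ℂ) = c

theorem CodegreesDvd.dvd {G : Type*} [Group G] {n d : ℕ} (h : CodegreesDvd G n)
    (hd : (d : ℂ) ∈ codSet G) : d ∣ n := by
  obtain ⟨e, he, hed⟩ := h _ hd
  rwa [← Nat.cast_injective hed]

/-! ### Characters nontrivial on a minimal normal commutator subgroup. -/

section MinimalCommutator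

variable {G : Type*} [Group G]
  (hmin : ∀ M : Subgroup G, M.Normal → M ≤ commutator G → M = ⊥ ∨ M = commutator G)
  {A : Subgroup G} (hNA : commutator G ≤ A) {θ : A →* ℂˣ} {n : G} (hn : n ∈ commutator G)
  (hθn : θ ⟨n, hNA hn⟩ ≠ 1)

include hmin hθn

theorem commutator_inf_coreKer : commutator G ⊓ coreKer A θ = ⊥ := by
  refine (hmin _ inferInstance inf_le_left).resolve_right fun h => hθn ?_
  exact apply_eq_one_of_mem_coreKer (inf_eq_left.1 h hn) _

theorem coreKer_le_center : coreKer A θ ≤ center G := by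
  intro k hk
  rw [mem_center_iff]
  intro g
  have h1 : ⁅g, k⁆ ∈ commutator G ⊓ coreKer A θ := by
    refine ⟨commutator_mem_commutator (mem_top g) (mem_top k), ?_⟩
    exact (coreKer A θ).mul_mem ((coreKer_normal A θ).conj_mem k hk g) ((coreKer A θ).inv_mem hk)
  rw [commutator_inf_coreKer hmin hNA hn hθn, mem_bot] at h1
  exact commutatorElement_eq_one_iff_mul_comm.1 h1

/-- If `g` fixes θ, then `⁅g, a⁆` lies in G' and in the core, hence is 1, so `g` centralizes `A`.
For membership in the core, put b = kak⁻¹: since kgk⁻¹ = g⁅g⁻¹, k⁆ with ⁅g⁻¹, k⁆ ∈ G' ≤ A commuting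
with b, the conjugate k⁅g, a⁆k⁻¹ equals gbg⁻¹b⁻¹, on which θ is 1. -/
theorem stabilizerLE_of_self_centralizing [hnormal : A.Normal]
    (hA : ∀ a ∈ A, ∀ b ∈ A, a * b = b * a) (hself : ∀ g, (∀ a ∈ A, g * a = a * g) → g ∈ A) :
    StabilizerLE A θ := by
  intro g hg
  by_contra! h
  refine hg (hself g fun a ha => ?_)
  have hcomm : ∀ x y : G, ⁅x, y⁆ ∈ commutator G := fun x y =>
    commutator_mem_commutator (mem_top x) (mem_top y)
  have h1 : ⁅g, a⁆ ∈ commutator G ⊓ coreKer A θ := by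
    refine ⟨hcomm g a, fun k => mem_map_ker.2 ?_⟩
    have hb : k * a * k⁻¹ ∈ A := hnormal.conj_mem a ha k
    set b : A := ⟨k * a * k⁻¹, hb⟩ with hbdef
    have hc : ⁅g⁻¹, k⁆ ∈ A := hNA (hcomm _ _)
    have h2 : ⁅g⁻¹, k⁆ * (b : G) * ⁅g⁻¹, k⁆⁻¹ = b := by
      rw [hA _ hc _ b.2, mul_inv_cancel_right]
    have h3 : k * ⁅g, a⁆ * k⁻¹ = g * b * g⁻¹ * (b : G)⁻¹ := by
      rw [← congrArg (fun x => g * x * g⁻¹ * (b : G)⁻¹) h2]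
      simp only [commutatorElement_def, hbdef]
      group
    have h4 : (⟨g * b * g⁻¹ * (b : G)⁻¹, mul_mem (hnormal.conj_mem b b.2 g) (inv_mem b.2)⟩ : A) =
        ⟨g * b * g⁻¹, hnormal.conj_mem b b.2 g⟩ * b⁻¹ := rfl
    rw [h3]
    refine ⟨mul_mem (hnormal.conj_mem b b.2 g) (inv_mem b.2), ?_⟩
    rw [h4, map_mul, map_inv, h b, mul_inv_cancel]
  rw [commutator_inf_coreKer hmin hNA hn hθn, mem_bot] at h1
  exact commutatorElement_eq_one_iff_mul_comm.1 h1

end MinimalCommutator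

/-- A minimal normal commutator subgroup of a solvable group is elementary abelian. -/
theorem exists_prime_pow_eq_one {G : Type*} [Group G] [Finite G] {N : Subgroup G} [hN : N.Normal]
    (hmin : ∀ M : Subgroup G, M.Normal → M ≤ N → M = ⊥ ∨ M = N)
    (hcomm : ∀ a ∈ N, ∀ b ∈ N, a * b = b * a) (hne : N ≠ ⊥) :
    ∃ l : ℕ, l.Prime ∧ ∀ a ∈ N, a ^ l = 1 := by
  have h1 : Nat.card N ≠ 1 := fun h => hne (card_eq_one.1 h)
  obtain ⟨l, hl, hdvd⟩ := Nat.exists_prime_and_dvd h1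
  have := Fact.mk hl
  obtain ⟨x, hx⟩ := exists_prime_orderOf_dvd_card' l hdvd
  -- The elements of `N` killed by `l` form a normal subgroup, nontrivial by Cauchy, hence all of
  -- `N`.
  let E : Subgroup G :=
    { carrier := {a | a ∈ N ∧ a ^ l = 1}
      one_mem' := ⟨one_mem _, one_pow _⟩
      mul_mem' := fun {a b} ha hb => ⟨mul_mem ha.1 hb.1, by
        rw [(show Commute a b from hcomm a ha.1 b hb.1).mul_pow, ha.2, hb.2, one_mul]⟩
      inv_mem' := fun {a} ha => ⟨inv_mem ha.1, by rw [inv_pow, ha.2, inv_one]⟩ }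
  have hE : E.Normal := ⟨fun a ha g => ⟨hN.conj_mem a ha.1 g, by
    rw [conj_pow, ha.2, mul_one, mul_inv_cancel]⟩⟩
  refine ⟨l, hl, fun a ha => ?_⟩
  have h2 : E = N := by
    refine (hmin E hE fun a ha => ha.1).resolve_left fun h => ?_
    have h3 : (x : G) ∈ E := ⟨x.2, by
      have h := pow_orderOf_eq_one x
      rw [hx] at h
      exact congrArg Subtype.val h⟩
    rw [h, mem_bot] at h3
    have h4 : x = 1 := Subtype.ext h3
    rw [h4, orderOf_one] at hx
    exact hl.one_lt.ne hx
  exact (h2.symm ▸ ha : a ∈ E).2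

theorem commutator_conj_mul {G : Type*} [Group G] (g a : G) : g * a * g⁻¹ = ⁅g, a⁆ * a := by
  simp [commutatorElement_def]

/-! ### Squarefree codegrees force commutativity. -/

/-- The case of a central commutator subgroup. -/
theorem false_of_commutator_le_center {G : Type*} [Group G] [Finite G] {n l : ℕ}
    (hcod : CodegreesDvd G n) (hn : Squarefree n) (hl : l.Prime)
    (hmin : ∀ M : Subgroup G, M.Normal → M ≤ commutator G → M = ⊥ ∨ M = commutator G)
    (hpow : ∀ a ∈ commutator G, a ^ l = 1) (hcard : Nat.card (commutator G) = l)
    (hZ : commutator G ≤ center G) : False := by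
  have hNcomm : ∀ a ∈ commutator G, ∀ b ∈ commutator G, a * b = b * a := fun a ha b _ =>
    (mem_center_iff.1 (hZ ha) b).symm
  obtain ⟨A, hNA, hA, hself⟩ := exists_self_centralizing hNcomm
  have hAn := normal_of_commutator_le hNA
  have hne : commutator G ≠ ⊥ := fun h => hl.one_lt.ne (by rw [← hcard, h, card_bot])
  obtain ⟨x, hxN, hx1⟩ := (bot_or_exists_ne_one _).resolve_left hne
  obtain ⟨θ, -, hθ⟩ := exists_character_ne_one hA ⊥ (hNA hxN) (by rwa [mem_bot])
  have hst := stabilizerLE_of_self_centralizing hmin hNA hxN hθ hA hself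
  have hdvd := hcod.dvd (relIndex_coreKer_mem_codSet A θ hst)
  have hKZ := coreKer_le_center hmin hNA hxN hθ
  have hZA : center G ≤ A := fun z hz => hself z fun a _ => (mem_center_iff.1 hz a).symm
  -- The codegree is |Z(G) : K| |A : Z(G)|, and `l` divides each factor.
  rw [← relIndex_mul_relIndex _ _ _ hKZ hZA] at hdvd
  have h1 : l ∣ (coreKer A θ).relIndex (center G) :=
    hcard ▸ card_dvd_relIndex hZ (commutator_inf_coreKer hmin hNA hxN hθ)
  have h2 : l ∣ (center G).relIndex A := by
    have hAZ : ¬ A ≤ center G := fun h => hne <| by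
      rw [commutator_eq_bot_iff_center_eq_top, eq_top_iff]
      intro g _
      exact h (hself g fun a ha => mem_center_iff.1 (h ha) g)
    obtain ⟨a, ha, haZ⟩ := Set.not_subset.1 hAZ
    have := Fact.mk hl
    -- `a ^ l` is central: its conjugate by `g` is (⁅g, a⁆a)^l = ⁅g, a⁆^l a^l = a^l, as ⁅g, a⁆ is
    -- central of exponent `l`.
    have hord : orderOf (QuotientGroup.mk' ((center G).subgroupOf A) ⟨a, ha⟩) = l := by
      refine orderOf_eq_prime ?_ fun h => haZ ?_
      swap
      · exact mem_subgroupOf.1 ((QuotientGroup.eq_one_iff (⟨a, ha⟩ : A)).1 h)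
      rw [← map_pow]
      refine (QuotientGroup.eq_one_iff _).2 ?_
      rw [mem_subgroupOf, mem_center_iff]
      intro g
      change g * a ^ l = a ^ l * g
      have hc : ⁅g, a⁆ ∈ commutator G := commutator_mem_commutator (mem_top g) (mem_top a)
      have h3 : g * a ^ l * g⁻¹ = a ^ l := by
        rw [← conj_pow, commutator_conj_mul,
          (show Commute ⁅g, a⁆ a from (mem_center_iff.1 (hZ hc) a).symm).mul_pow, hpow _ hc, one_mul]
      rw [← mul_inv_eq_iff_eq_mul, h3]
    rw [← hord]
    exact orderOf_dvd_natCard _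
  exact hl.not_isUnit (hn l ((mul_dvd_mul h1 h2).trans hdvd))

/-- The case of a noncentral commutator subgroup. -/
theorem false_of_commutator_inf_center {G : Type*} [Group G] [Finite G] {n l : ℕ}
    (hcod : CodegreesDvd G n) (hn : Squarefree n) (hl : l.Prime)
    (hindex : l ∣ (commutator G).index)
    (hmin : ∀ M : Subgroup G, M.Normal → M ≤ commutator G → M = ⊥ ∨ M = commutator G)
    (hcomm : ∀ a ∈ commutator G, ∀ b ∈ commutator G, a * b = b * a)
    (hcard : Nat.card (commutator G) = l) (hZ : commutator G ⊓ center G = ⊥) : False := by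
  have := Fact.mk hl
  set A : Subgroup G := centralizer (commutator G : Set G) with hAdef
  have hNA : commutator G ≤ A := fun a ha => mem_centralizer_iff.2 fun b hb => hcomm b hb a ha
  have hAn := normal_of_commutator_le hNA
  have hA : ∀ a ∈ A, ∀ b ∈ A, a * b = b * a := by
    intro a ha b hb
    have h1 : ⁅a, b⁆ ∈ commutator G ⊓ center G :=
      ⟨commutator_mem_commutator (mem_top a) (mem_top b),
        commutator_centralizer_commutator_le_center G (commutator_mem_commutator ha hb)⟩
    rw [hZ, mem_bot] at h1
    exact commutatorElement_eq_one_iff_mul_comm.1 h1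
  have hself : ∀ g, (∀ a ∈ A, g * a = a * g) → g ∈ A := fun g hg =>
    mem_centralizer_iff.2 fun a ha => (hg a (hNA ha)).symm
  have hZA : center G ≤ A := fun z hz => hself z fun a _ => (mem_center_iff.1 hz a).symm
  have hne : commutator G ≠ ⊥ := fun h => hl.one_lt.ne (by rw [← hcard, h, card_bot])
  obtain ⟨x, hxN, hx1⟩ := (bot_or_exists_ne_one _).resolve_left hne
  obtain ⟨θ, -, hθ⟩ := exists_character_ne_one hA ⊥ (hNA hxN) (by rwa [mem_bot])
  have hdvd : ∀ {η : A →* ℂˣ}, η ⟨x, hNA hxN⟩ ≠ 1 → (coreKer A η).relIndex A ∣ n := fun hη =>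
    hcod.dvd (relIndex_coreKer_mem_codSet A _
      (stabilizerLE_of_self_centralizing hmin hNA hxN hη hA hself))
  have hsq : ∀ {m : ℕ}, m ∣ n → ¬ l * l ∣ m := fun hm h => hl.not_isUnit (hn l (h.trans hm))
  -- The kernel of the conjugation action on G' lies in `A`, and Aut(G') has order l − 1, so |G : A|
  -- divides l − 1.
  have hAindex : ¬ l ∣ A.index := by
    intro h
    have hker : (MulAut.conjNormal : G →* MulAut (commutator G)).ker ≤ A := by
      intro g hg
      refine mem_centralizer_iff.2 fun a ha => ?_
      have h1 := congrArg (fun f : MulAut (commutator G) => (f ⟨a, ha⟩ : G)) (MonoidHom.mem_ker.1 hg)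
      simp only [MulAut.conjNormal_apply, MulAut.one_apply] at h1
      exact (mul_inv_eq_iff_eq_mul.1 h1).symm
    have h2 : Nat.card (MulAut (commutator G)) = l - 1 := by
      have : IsCyclic (commutator G) := isCyclic_of_prime_card hcard
      rw [IsCyclic.card_mulAut, hcard, Nat.totient_prime hl]
    have h3 := (h.trans (index_dvd_of_le hker)).trans
      ((index_ker (MulAut.conjNormal : G →* MulAut (commutator G))).dvd.trans (card_subgroup_dvd_card _))
    rw [h2] at h3
    have h4 := Nat.le_of_dvd (Nat.sub_pos_of_lt hl.one_lt) h3
    have h5 := hl.pos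
    omega
  have hAcard : l * l ∣ Nat.card A := by
    rw [← relIndex_mul_index hNA] at hindex
    have h1 := (hl.dvd_mul.1 hindex).resolve_right hAindex
    rw [← relIndex_bot_left, ← relIndex_mul_relIndex ⊥ (commutator G) A bot_le hNA,
      relIndex_bot_left, hcard]
    exact mul_dvd_mul_left l h1
  -- l² divides |A| but not the codegree |A : K|.
  have hKcard : l ∣ Nat.card (coreKer A θ) := by
    rw [← relIndex_bot_left, ← relIndex_mul_relIndex ⊥ (coreKer A θ) A bot_le coreKer_le,
      relIndex_bot_left] at hAcard
    by_contra h
    have h1 : (l * l).Coprime (Nat.card (coreKer A θ)) :=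
      Nat.Coprime.mul_left ((Nat.Prime.coprime_iff_not_dvd hl).2 h)
        ((Nat.Prime.coprime_iff_not_dvd hl).2 h)
    exact hsq (hdvd hθ) (h1.dvd_of_dvd_mul_left hAcard)
  obtain ⟨z, hz⟩ := exists_prime_orderOf_dvd_card' l hKcard
  have hz1 : (z : G) ≠ 1 := fun h => hl.one_lt.ne <| by
    rw [← hz, show z = 1 from Subtype.ext h, orderOf_one]
  have hzZ : (z : G) ∈ center G := coreKer_le_center hmin hNA hxN hθ z.2
  have hzN : (z : G) ∉ commutator G := fun h => hz1 <| by
    have h1 : (z : G) ∈ commutator G ⊓ center G := ⟨h, hzZ⟩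
    rwa [hZ, mem_bot] at h1
  -- Twisting by μ leaves θ unchanged on G' but expels `z` from the core, because θ is 1 at `z` and
  -- μ is not.
  obtain ⟨μ, hμ, hμz⟩ := exists_character_ne_one hA (commutator G) (hZA hzZ) hzN
  have hη : (θ * μ) ⟨x, hNA hxN⟩ ≠ 1 := by
    rwa [MonoidHom.mul_apply, hμ _ hxN, mul_one]
  have hηz : (θ * μ) ⟨z, hZA hzZ⟩ ≠ 1 := by
    rwa [MonoidHom.mul_apply, apply_eq_one_of_mem_coreKer z.2, one_mul]
  refine hsq (hdvd hη) ?_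
  -- The new core meets ⟨z⟩ ≤ Z(G) trivially, and Z(G) meets G' trivially; each gives a factor `l`.
  rw [← relIndex_mul_relIndex _ _ _ (coreKer_le_center hmin hNA hxN hη) hZA]
  apply mul_dvd_mul
  · have hzcard : Nat.card (zpowers (z : G)) = l := by
      rw [Nat.card_zpowers, orderOf_coe, hz]
    rw [← hzcard]
    apply card_dvd_relIndex
    · rwa [zpowers_le]
    · have : Fact (Nat.card (zpowers (z : G))).Prime := ⟨hzcard ▸ hl⟩
      rw [inf_comm, ← disjoint_iff, ← subgroupOf_eq_bot]
      refine (eq_bot_or_eq_top_of_prime_card _).resolve_right fun h => hηz ?_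
      rw [subgroupOf_eq_top, zpowers_le] at h
      exact apply_eq_one_of_mem_coreKer h _
  · exact hcard ▸ card_dvd_relIndex hNA hZ

/-- A solvable group whose codegrees divide a squarefree number, all of whose prime divisors divide
the order of the abelianization, is abelian. -/
theorem commutator_eq_bot_of_codegreesDvd {n : ℕ} (hn : Squarefree n) (G : Type*) [Group G]
    [Finite G] [Group.IsSolvable G] (hcod : CodegreesDvd G n)
    (hindex : ∀ l : ℕ, l.Prime → l ∣ n → l ∣ (commutator G).index) : commutator G = ⊥ := by
  induction hc : Nat.card G using Nat.strong_induction_on generalizing G with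
  | _ m ih =>
  subst hc
  by_contra hne
  -- For M ≠ 1 induction makes G/M abelian, forcing M = G'. The condition on primes descends because
  -- M ≤ G' leaves the index of the commutator subgroup unchanged.
  have hmin : ∀ M : Subgroup G, M.Normal → M ≤ commutator G → M = ⊥ ∨ M = commutator G := by
    intro M hM hle
    by_contra! h
    have hcomap : (commutator (G ⧸ M)).comap (QuotientGroup.mk' M) = commutator G := by
      have h1 : commutator (G ⧸ M) = (commutator G).map (QuotientGroup.mk' M) := by
        rw [commutator_def, commutator_def, map_commutator,
          map_top_of_surjective _ (QuotientGroup.mk'_surjective M)]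
      rw [h1, comap_map_eq, QuotientGroup.ker_mk', sup_eq_left.2 hle]
    have h1 : commutator (G ⧸ M) = ⊥ := by
      refine ih _ ?_ (G ⧸ M) (fun c hc => hcod c (codSet_quotient_subset M hc)) ?_ rfl
      · have h2 : Nat.card M ≠ 1 := fun h2 => h.1 (card_eq_one.1 h2)
        have h3 : 0 < Nat.card M := Nat.card_pos
        have h4 : 0 < Nat.card (G ⧸ M) := Nat.card_pos
        rw [M.card_eq_card_quotient_mul_card_subgroup]
        nlinarith [show 2 ≤ Nat.card M by omega]
      · intro l hl hln
        rw [← index_comap_of_surjective _ (QuotientGroup.mk'_surjective M), hcomap]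
        exact hindex l hl hln
    rw [h1, MonoidHom.comap_bot, QuotientGroup.ker_mk'] at hcomap
    exact h.2 hcomap
  have hcomm : ∀ a ∈ commutator G, ∀ b ∈ commutator G, a * b = b * a := by
    have h1 : ⁅commutator G, commutator G⁆ = ⊥ :=
      (hmin _ inferInstance (Group.IsSolvable.commutator_lt_of_ne_bot hne).le).resolve_right
        (Group.IsSolvable.commutator_lt_of_ne_bot hne).ne
    intro a ha b hb
    have h2 := commutator_mem_commutator ha hb
    rw [h1, mem_bot] at h2
    exact commutatorElement_eq_one_iff_mul_comm.1 h2
  obtain ⟨l, hl, hpow⟩ := exists_prime_pow_eq_one hmin hcomm hne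
  have := Fact.mk hl
  have hcard : Nat.card (commutator G) ∣ n := by
    obtain ⟨A, hNA, hA, hself⟩ := exists_self_centralizing hcomm
    have hAn := normal_of_commutator_le hNA
    obtain ⟨x, hxN, hx1⟩ := (bot_or_exists_ne_one _).resolve_left hne
    obtain ⟨θ, -, hθ⟩ := exists_character_ne_one hA ⊥ (hNA hxN) (by rwa [mem_bot])
    have hst := stabilizerLE_of_self_centralizing hmin hNA hxN hθ hA hself
    exact (card_dvd_relIndex hNA (commutator_inf_coreKer hmin hNA hxN hθ)).trans
      (hcod.dvd (relIndex_coreKer_mem_codSet A θ hst))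
  have hcardl : Nat.card (commutator G) = l := by
    have hp : IsPGroup l (commutator G) := fun a => ⟨1, Subtype.ext (by simpa using hpow a a.2)⟩
    obtain ⟨k, hk⟩ := hp.exists_card_eq
    have h1 : k ≠ 0 := fun h => hne (card_eq_one.1 (by rw [hk, h, pow_zero]))
    have h2 : Squarefree (l ^ k) := hn.squarefree_of_dvd (hk ▸ hcard)
    rw [hk, ((Nat.squarefree_pow_iff hl.one_lt.ne' h1).1 h2).2, pow_one]
  rcases hmin (commutator G ⊓ center G) inferInstance inf_le_left with h | h
  · exact false_of_commutator_inf_center hcod hn hl (hindex l hl (hcardl ▸ hcard)) hmin hcomm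
      hcardl h
  · exact false_of_commutator_le_center hcod hn hl hmin hpow hcardl (inf_eq_left.1 h)

/-! ### Primes of the nilpotent quotient and of the abelianization. -/

/-- A prime dividing the order of a nilpotent group divides that of its abelianization. -/
theorem prime_dvd_index_commutator {H : Type*} [Group H] [Finite H] [Group.IsNilpotent H] {p : ℕ}
    (hp : p.Prime) (hdvd : p ∣ Nat.card H) : p ∣ (commutator H).index := by
  have := Fact.mk hp
  -- A finite nilpotent group is the product of its Sylow subgroups, so it maps onto its Sylow
  -- `p`-subgroup `P`.
  obtain ⟨e⟩ := (Group.isNilpotent_of_finite_tfae (G := H)).out 0 4 rfl rfl |>.mp ‹_›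
  let i : (Nat.card H).primeFactors :=
    ⟨p, Nat.mem_primeFactors.2 ⟨hp, hdvd, Nat.card_pos.ne'⟩⟩
  let P : Sylow i H := default
  let f₁ : (∀ j : (Nat.card H).primeFactors, ∀ R : Sylow j H, (R : Subgroup H)) →*
      ∀ R : Sylow i H, (R : Subgroup H) := Pi.evalMonoidHom _ i
  let f₂ : (∀ R : Sylow i H, (R : Subgroup H)) →* (P : Subgroup H) := Pi.evalMonoidHom _ P
  have hf₁ : Function.Surjective f₁ := Function.surjective_eval i
  have hf₂ : Function.Surjective f₂ := Function.surjective_eval P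
  have hf : Function.Surjective ((f₂.comp f₁).comp e.symm.toMonoidHom) :=
    (hf₂.comp hf₁).comp e.symm.surjective
  refine dvd_trans ?_ (index_commutator_dvd_of_surjective hf)
  have hP : IsPGroup p P := P.isPGroup'
  have : Nontrivial P := by
    rw [← Finite.one_lt_card_iff_nontrivial]
    exact hp.one_lt.trans_le (Nat.le_of_dvd Nat.card_pos (P.dvd_card_of_dvd_card hdvd))
  have : Group.IsNilpotent P := inferInstance
  obtain ⟨k, hk⟩ := hP.exists_card_eq
  -- |P : P'| is a power of `p`, and it is not 1 because P' is proper in the nontrivial solvable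
  -- group `P`.
  obtain ⟨j, -, hj⟩ := (Nat.dvd_prime_pow hp).1 (hk ▸ index_dvd_card (commutator P))
  rw [hj]
  refine dvd_pow_self p fun h => ?_
  rw [h, pow_zero, index_eq_one] at hj
  exact (Group.IsSolvable.commutator_lt_top_of_nontrivial P).ne hj

/-- G/N embeds in the product of the nilpotent quotients of G, so it is itself nilpotent. -/
theorem prime_dvd_index_commutator_of_nilpotentResidual {G : Type*} [Group G] [Finite G] {p : ℕ}
    (hp : p.Prime) (hdvd : p ∣ Nat.card (G ⧸ nilpotentResidual G)) :
    p ∣ (commutator G).index := by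
  let S := {K : Subgroup G // ∃ _ : K.Normal, Group.IsNilpotent (G ⧸ K)}
  have hS : ∀ K : S, K.1.Normal := fun K => K.2.1
  have hS' : ∀ K : S, Group.IsNilpotent (G ⧸ K.1) := fun K => K.2.2
  let f : G →* ∀ K : S, G ⧸ K.1 := MonoidHom.pi fun K => QuotientGroup.mk' K.1
  have hker : f.ker = nilpotentResidual G := by
    ext g
    rw [MonoidHom.mem_ker, nilpotentResidual, mem_sInf, funext_iff]
    exact ⟨fun h K hK => have := hK.1; (QuotientGroup.eq_one_iff g).1 (h ⟨K, hK⟩),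
      fun h K => (QuotientGroup.eq_one_iff g).2 (h K.1 K.2)⟩
  have hcard : p ∣ Nat.card f.range := by
    rwa [← index_ker, hker]
  exact (prime_dvd_index_commutator hp hcard).trans
    (index_commutator_dvd_of_surjective f.rangeRestrict_surjective)

/-! ### Orders of linear characters and divisors of pq. -/

/-- The image of θ is a finite subgroup of ℂˣ, hence cyclic, so its order is its exponent, which is
the order of θ. -/
theorem index_ker_eq_orderOf {G : Type*} [Group G] [Finite G] (θ : G →* ℂˣ) :
    θ.ker.index = orderOf θ := by
  have : Finite θ.range := Finite.of_surjective _ θ.rangeRestrict_surjective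
  rw [index_ker, ← IsCyclic.exponent_eq_card]
  apply Nat.dvd_antisymm
  · refine Monoid.exponent_dvd_of_forall_pow_eq_one ?_
    rintro ⟨_, g, rfl⟩
    exact Subtype.ext (DFunLike.congr_fun (pow_orderOf_eq_one θ) g)
  · refine orderOf_dvd_of_pow_eq_one (MonoidHom.ext fun g => ?_)
    exact congrArg Subtype.val (Monoid.pow_exponent_eq_one (⟨θ g, g, rfl⟩ : θ.range))

/-- The linear characters of `G` are counted by the abelianization. -/
theorem card_linearCharacters (G : Type*) [Group G] [Finite G] :
    Nat.card (G →* ℂˣ) = (commutator G).index := by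
  rw [Nat.card_congr (Abelianization.lift (G := G) (A := ℂˣ)),
    CommGroup.card_monoidHom_of_hasEnoughRootsOfUnity]
  rfl

theorem exists_orderOf_eq_of_dvd {X : Type*} [CommGroup X] [Finite X] {p q : ℕ} (hp : p.Prime)
    (hq : q.Prime) (hpq : p ≠ q) (hpX : p ∣ Nat.card X) (hqX : q ∣ Nat.card X) {d : ℕ}
    (hd : d ∣ p * q) : ∃ x : X, orderOf x = d := by
  have := Fact.mk hp
  have := Fact.mk hq
  obtain ⟨x, hx⟩ := exists_prime_orderOf_dvd_card' p hpX
  obtain ⟨y, hy⟩ := exists_prime_orderOf_dvd_card' q hqX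
  have h1 : orderOf (x * y) = p * q := by
    rw [(Commute.all x y).orderOf_mul_eq_mul_orderOf_of_coprime, hx, hy]
    rw [hx, hy]
    exact (Nat.coprime_primes hp hq).2 hpq
  refine ⟨(x * y) ^ (orderOf (x * y) / d), ?_⟩
  rw [← h1] at hd
  exact orderOf_pow_orderOf_div (orderOf_pos _).ne' hd

theorem exists_linearCharacter_orderOf {G : Type*} [Group G] [Finite G] {p q : ℕ} (hp : p.Prime)
    (hq : q.Prime) (hpq : p ≠ q) (hpG : p ∣ (commutator G).index)
    (hqG : q ∣ (commutator G).index) {d : ℕ} (hd : d ∣ p * q) : ∃ θ : G →* ℂˣ, orderOf θ = d := by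
  have : Finite (G →* ℂˣ) := Nat.finite_of_card_ne_zero <| by
    rw [card_linearCharacters]
    exact index_ne_zero_of_finite
  rw [← card_linearCharacters] at hpG hqG
  exact exists_orderOf_eq_of_dvd hp hq hpq hpG hqG hd

/-- The divisors of `n`, as complex numbers. -/
noncomputable def divisorSet (n : ℕ) : Set ℂ :=
  (fun d : ℕ => (d : ℂ)) '' n.divisors

theorem ncard_divisorSet {p q : ℕ} (hp : p.Prime) (hq : q.Prime) (hpq : p ≠ q) :
    (divisorSet (p * q)).ncard = 4 := by
  rw [divisorSet, Set.ncard_image_of_injective _ Nat.cast_injective, Set.ncard_coe_finset,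
    ((Nat.coprime_primes hp hq).2 hpq).card_divisors_mul, hp.divisors, hq.divisors,
    Finset.card_pair hp.one_lt.ne, Finset.card_pair hq.one_lt.ne]

theorem divisorSet_subset_codSet {G : Type*} [Group G] [Finite G] {p q : ℕ} (hp : p.Prime)
    (hq : q.Prime) (hpq : p ≠ q) (hpG : p ∣ (commutator G).index)
    (hqG : q ∣ (commutator G).index) : divisorSet (p * q) ⊆ codSet G := by
  rintro _ ⟨d, hd, rfl⟩
  obtain ⟨θ, rfl⟩ := exists_linearCharacter_orderOf hp hq hpq hpG hqG (Nat.dvd_of_mem_divisors hd)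
  have h := index_ker_mem_codSet θ
  rwa [index_ker_eq_orderOf] at h

theorem codegreesDvd_iff_subset {G : Type*} [Group G] {n : ℕ} (hn : n ≠ 0) :
    CodegreesDvd G n ↔ codSet G ⊆ divisorSet n := by
  simp [CodegreesDvd, divisorSet, Set.subset_def, hn]

/-! ### Abelian groups: codegrees, exponent and direct decomposition. -/

/-- Every irreducible codegree of an abelian group is the index of the kernel of a linear
character. -/
theorem exists_linearCharacter_of_mem_codSet {G : Type*} [Group G] [Finite G]
    (hG : ∀ a b : G, a * b = b * a) {c : ℂ} (hc : c ∈ codSet G) :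
    ∃ θ : G →* ℂˣ, (θ.ker.index : ℂ) = c := by
  obtain ⟨_, ⟨V, _, _, _, ρ, hρ, rfl⟩, rfl⟩ := hc
  have : IsMulCommutative G := ⟨⟨hG⟩⟩
  have h1 : Module.finrank ℂ V = 1 :=
    Representation.IsIrreducible.finrank_eq_one_of_isMulCommutative ρ
  -- In dimension one `ρ g` is the scalar `det (ρ g)`, so the determinant has the same kernel as ρ.
  refine ⟨(LinearMap.det.comp ρ).toHomUnits, ?_⟩
  rw [cod_character, h1, Nat.cast_one, div_one]
  congr 2
  ext g
  rw [MonoidHom.mem_ker, MonoidHom.mem_ker, ← Units.val_inj]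
  obtain ⟨c, hc, -⟩ := LinearMap.existsUnique_eq_smul_id_of_finrank_eq_one h1 (ρ g)
  simp only [MonoidHom.coe_toHomUnits, MonoidHom.comp_apply, Units.val_one]
  refine ⟨fun h => ?_, fun h => by rw [h, map_one]⟩
  rw [hc, LinearMap.det_smul, h1, pow_one, LinearMap.det_id, mul_one] at h
  rw [hc, h, one_smul]
  rfl

theorem codegreesDvd_of_pow_eq_one {G : Type*} [Group G] [Finite G]
    (hG : ∀ a b : G, a * b = b * a) {n : ℕ} (hn : ∀ g : G, g ^ n = 1) : CodegreesDvd G n := by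
  intro c hc
  obtain ⟨θ, rfl⟩ := exists_linearCharacter_of_mem_codSet hG hc
  refine ⟨_, ?_, rfl⟩
  rw [index_ker_eq_orderOf]
  refine orderOf_dvd_of_pow_eq_one (MonoidHom.ext fun g => ?_)
  rw [MonoidHom.pow_apply, ← map_pow, hn, map_one, MonoidHom.one_apply]

/-- A linear character nontrivial at `g ^ n` would have order, hence codegree, not dividing `n`. -/
theorem CodegreesDvd.pow_eq_one {G : Type*} [Group G] [Finite G]
    (hG : ∀ a b : G, a * b = b * a) {n : ℕ} (hn : CodegreesDvd G n) (g : G) : g ^ n = 1 := by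
  by_contra h
  obtain ⟨θ, -, hθ⟩ := exists_character_ne_one (A := (⊤ : Subgroup G)) (fun a _ b _ => hG a b) ⊥
    (mem_top (g ^ n)) (by rwa [mem_bot])
  let η : G →* ℂˣ := θ.comp topEquiv.symm.toMonoidHom
  have h1 := hn.dvd (index_ker_mem_codSet η)
  rw [index_ker_eq_orderOf, orderOf_dvd_iff_pow_eq_one] at h1
  apply hθ
  have h2 := DFunLike.congr_fun h1 g
  rwa [MonoidHom.pow_apply, ← map_pow] at h2

theorem exists_isDirectProduct {G : Type*} [Group G] (hG : ∀ a b : G, a * b = b * a) {p q : ℕ}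
    (hpq : p.Coprime q) (hpow : ∀ g : G, g ^ (p * q) = 1) :
    ∃ P Q : Subgroup G, IsElementaryAbelian p P ∧ IsElementaryAbelian q Q ∧
      IsDirectProduct P Q := by
  let _ : CommGroup G := { (inferInstance : Group G) with mul_comm := hG }
  refine ⟨(powMonoidHom p : G →* G).ker, (powMonoidHom q : G →* G).ker,
    ⟨fun a b => Subtype.ext (hG a b), fun a => Subtype.ext a.2⟩,
    ⟨fun a b => Subtype.ext (hG a b), fun a => Subtype.ext a.2⟩,
    inferInstance, inferInstance, ?_, ?_⟩
  · rw [eq_bot_iff]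
    rintro x ⟨hx, hy⟩
    have h1 := Nat.dvd_gcd (orderOf_dvd_of_pow_eq_one (show x ^ p = 1 from hx))
      (orderOf_dvd_of_pow_eq_one (show x ^ q = 1 from hy))
    rw [hpq.gcd_eq_one, Nat.dvd_one, orderOf_eq_one_iff] at h1
    exact h1
  · rw [eq_top_iff]
    intro g _
    have hz : g ^ ((p : ℤ) * q) = 1 := by
      rw [← Nat.cast_mul, zpow_natCast, hpow]
    -- Bézout's identity writes 1 as a multiple of `q` plus a multiple of `p`; these powers of `g`
    -- are killed by `p` and by `q` respectively.
    refine mem_sup_of_normal_left.2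
      ⟨g ^ ((q : ℤ) * p.gcdB q), ?_, g ^ ((p : ℤ) * p.gcdA q), ?_, ?_⟩
    · change (g ^ ((q : ℤ) * p.gcdB q)) ^ p = 1
      rw [← zpow_natCast, ← zpow_mul, show (q : ℤ) * p.gcdB q * p = p * q * p.gcdB q by ring,
        zpow_mul, hz, one_zpow]
    · change (g ^ ((p : ℤ) * p.gcdA q)) ^ q = 1
      rw [← zpow_natCast, ← zpow_mul, show (p : ℤ) * p.gcdA q * q = p * q * p.gcdA q by ring,
        zpow_mul, hz, one_zpow]
    · rw [← zpow_add, add_comm, ← Nat.gcd_eq_gcd_ab, hpq.gcd_eq_one, Nat.cast_one, zpow_one]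

theorem IsDirectProduct.exists_mul {G : Type*} [Group G] {P Q : Subgroup G}
    (h : IsDirectProduct P Q) (g : G) : ∃ x ∈ P, ∃ y ∈ Q, x * y = g := by
  have := h.1
  exact mem_sup_of_normal_left.1 (h.2.2.2 ▸ mem_top g)

theorem IsDirectProduct.comm_and_pow_eq_one {G : Type*} [Group G] {p q : ℕ} {P Q : Subgroup G}
    (h : IsDirectProduct P Q) (hP : IsElementaryAbelian p P) (hQ : IsElementaryAbelian q Q) :
    (∀ a b : G, a * b = b * a) ∧ ∀ g : G, g ^ (p * q) = 1 := by
  have hc : ∀ x ∈ P, ∀ y ∈ Q, Commute x y := fun x hx y hy =>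
    commute_of_normal_of_disjoint P Q h.1 h.2.1 (disjoint_iff.2 h.2.2.1) x y hx hy
  have hPc : ∀ x ∈ P, ∀ y ∈ P, Commute x y := fun x hx y hy =>
    congrArg Subtype.val (hP.1 ⟨x, hx⟩ ⟨y, hy⟩)
  have hQc : ∀ x ∈ Q, ∀ y ∈ Q, Commute x y := fun x hx y hy =>
    congrArg Subtype.val (hQ.1 ⟨x, hx⟩ ⟨y, hy⟩)
  constructor
  · intro a b
    obtain ⟨x, hx, y, hy, rfl⟩ := h.exists_mul a
    obtain ⟨z, hz, w, hw, rfl⟩ := h.exists_mul b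
    exact ((hPc x hx z hz).mul_right (hc x hx w hw)).mul_left
      ((hc z hz y hy).symm.mul_right (hQc y hy w hw))
  · intro g
    obtain ⟨x, hx, y, hy, rfl⟩ := h.exists_mul g
    have h1 : x ^ p = 1 := congrArg Subtype.val (hP.2 ⟨x, hx⟩)
    have h2 : y ^ q = 1 := congrArg Subtype.val (hQ.2 ⟨y, hy⟩)
    rw [(hc x hx y hy).mul_pow, pow_mul, h1, one_pow, mul_comm p q, pow_mul, h2, one_pow, one_mul]

theorem eq_or_eq_of_dvd_card {G : Type*} [Group G] [Finite G] {p q r : ℕ} (hp : p.Prime)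
    (hq : q.Prime) (hr : r.Prime) (hpow : ∀ g : G, g ^ (p * q) = 1) (hrG : r ∣ Nat.card G) :
    r = p ∨ r = q := by
  have := Fact.mk hr
  obtain ⟨g, hg⟩ := exists_prime_orderOf_dvd_card' r hrG
  have h := hg ▸ orderOf_dvd_of_pow_eq_one (hpow g)
  rcases hr.dvd_mul.1 h with h | h
  · exact Or.inl ((Nat.prime_dvd_prime_iff_eq hr hp).1 h)
  · exact Or.inr ((Nat.prime_dvd_prime_iff_eq hr hq).1 h)

end CharacterCodegree

/-! ### The equivalence. -/

open CharacterCodegree in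
theorem mainTheorem7 (G : Type*) [Group G] [Finite G] [Group.IsSolvable G]
    (hG : 1 < (Nat.card (G ⧸ nilpotentResidual G)).primeFactors.card) :
    (codSet G).ncard = 4 ↔
      ∃ (p q : ℕ) (P Q : Subgroup G), p.Prime ∧ q.Prime ∧ p ≠ q ∧
        IsElementaryAbelian p P ∧ IsElementaryAbelian q Q ∧ IsDirectProduct P Q := by
  obtain ⟨p, hp, q, hq, hpq⟩ := Finset.one_lt_card.1 hG
  have hpG := prime_dvd_index_commutator_of_nilpotentResidual (Nat.prime_of_mem_primeFactors hp)
    (Nat.dvd_of_mem_primeFactors hp)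
  have hqG := prime_dvd_index_commutator_of_nilpotentResidual (Nat.prime_of_mem_primeFactors hq)
    (Nat.dvd_of_mem_primeFactors hq)
  replace hp := Nat.prime_of_mem_primeFactors hp
  replace hq := Nat.prime_of_mem_primeFactors hq
  have hsub := divisorSet_subset_codSet hp hq hpq hpG hqG
  have hcop := (Nat.coprime_primes hp hq).2 hpq
  have h0 : p * q ≠ 0 := mul_ne_zero hp.ne_zero hq.ne_zero
  constructor
  · intro h4
    -- `ncard` is 0 on infinite sets, so the value 4 forces finiteness.
    have hfin : (codSet G).Finite := Set.finite_of_ncard_ne_zero (by rw [h4]; norm_num)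
    have heq : divisorSet (p * q) = codSet G :=
      Set.eq_of_subset_of_ncard_le hsub (by rw [h4, ncard_divisorSet hp hq hpq]) hfin
    have hcod : CodegreesDvd G (p * q) := (codegreesDvd_iff_subset h0).2 heq.ge
    have hbot := commutator_eq_bot_of_codegreesDvd
      ((Nat.squarefree_mul hcop).2 ⟨hp.prime.squarefree, hq.prime.squarefree⟩) G hcod
      fun l hl hlpq => by
        rcases hl.dvd_mul.1 hlpq with h | h
        · rwa [(Nat.prime_dvd_prime_iff_eq hl hp).1 h]
        · rwa [(Nat.prime_dvd_prime_iff_eq hl hq).1 h]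
    have hcomm : ∀ a b : G, a * b = b * a := ((commutator_eq_bot_iff G).1 hbot).is_comm.comm
    obtain ⟨P, Q, hP, hQ, hPQ⟩ := exists_isDirectProduct hcomm hcop (hcod.pow_eq_one hcomm)
    exact ⟨p, q, P, Q, hp, hq, hpq, hP, hQ, hPQ⟩
  · rintro ⟨r, s, P, Q, hr, hs, hrs, hP, hQ, hPQ⟩
    obtain ⟨hcomm, hpow⟩ := hPQ.comm_and_pow_eq_one hP hQ
    -- `p` and `q` divide |G|, whose prime divisors are among `r` and `s`.
    have hprod : r * s = p * q := by
      have h1 := eq_or_eq_of_dvd_card hr hs hp hpow (hpG.trans (Subgroup.index_dvd_card _))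
      have h2 := eq_or_eq_of_dvd_card hr hs hq hpow (hqG.trans (Subgroup.index_dvd_card _))
      rcases h1 with rfl | rfl <;> rcases h2 with rfl | rfl
      · exact absurd rfl hpq
      · rfl
      · exact mul_comm _ _
      · exact absurd rfl hpq
    have hcod := codegreesDvd_of_pow_eq_one hcomm hpow
    rw [hprod, codegreesDvd_iff_subset h0] at hcod
    rw [hcod.antisymm hsub, ncard_divisorSet hp hq hpq]
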